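/- Let $K$ be a field. A \emph{graded filtered Floer--Novikov complex} $\mathfrak{c}=(\pi\colon P\to S,\mathcal{A},\omega,gr,deg,\partial)$ over $K$ consists of the following data. $\Gamma$ is a finitely generated abelian group (written multiplicatively), $S$ is a finite set, and $\pi\colon P\to S$ is a principal $\Gamma$-bundle. There are functions $\mathcal{A}\colon P\to\mathbb{R}$, $gr\colon P\to\mathbb{Z}$ and homomorphisms $\omega\colon\Gamma\to\mathbb{R}$, $deg\colon\Gamma\to\mathbb{Z}$ with $\mathcal{A}(g\cdot p)=\mathcal{A}(p)-\omega(g)$ and $gr(g\cdot p)=gr(p)-deg(g)$ for $g\in\Gamma$, $p\in P$. Let $C_k=C_k(\mathfrak{c})$ be the $K$-vector space of formal sums $\sum_{p\in P,\,gr(p)=k}c_p\,p$ with $c_p\in K$ such that for every $C\in\mathbb{R}$ only finitely many $p$ have $c_p\ne0$ and $\mathcal{A}(p)>C$, and let $C_*=\bigoplus_{k\in\mathbb{Z}}C_k$. Let $\bar\Lambda$ be the Novikov ring of formal sums $\sum_{g\in\Gamma}b_g\,g$ with $b_g\in K$ such that $\{deg(g)\mid b_g\neq0\}$ is finite and for every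 $C\in\mathbb{R}$ only finitely many $g$ have $b_g\ne0$ and $\omega(g)<C$; it acts on $C_*$ through the $\Gamma$-action on $P$. Put $\ell(\sum c_p\,p)=\max\{\mathcal{A}(p)\mid c_p\ne0\}$ and $\ell(0)=-\infty$. Finally, $\partial\colon C_*\to C_*$ is a $\bar\Lambda$-module endomorphism with $\partial^2=0$, $\partial(C_k)\subset C_{k-1}$ for all $k$, and $\ell(\partial c)<\ell(c)$ for all $c\ne0$. For $a\in H_k(C_*)$ the \emph{spectral number} is $\rho_{\mathfrak{c}}(a)=\inf\{\ell(c)\mid c\in C_k,\ \partial c=0,\ [c]=a\}$. Write $\partial p=\sum_{q\in P}n(p,q)\,q$ for $p\in P$. The \emph{opposite complex} is $\mathfrak{c}^{op}=(\pi\colon P\to S,-\mathcal{A},\omega,-gr,deg,\delta)$, where $g\in\Gamma$ now acts on $P$ by $p\mapsto g^{-1}\cdot p$ and $\delta$ is determined by $\delta p=\sum_{q\in P}n(q,p)\,q$; it is again a graded filtered Floer--Novikov complex. Let $D_*=C_*(\mathfrak{c}^{op})$ be its chain complex. The pairing $\Delta\left(\sum d_p\,p,\sum c_p\,p\right)=\sum_{p\in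 P}d_pc_p$ on $D_*\times C_*$ satisfies $\Delta(\delta d,c)=\Delta(d,\partial c)$ and hence induces a $K$-bilinear pairing $\underline{\Delta}\colon H_{-k}(D_*)\times H_k(C_*)\to K$ for every $k\in\mathbb{Z}$. Suppose that $\omega$ is injective on $\ker(deg)$, let $k\in\mathbb{Z}$, and let $a\in H_k(C_*)$ be nonzero. Then $\rho_{\mathfrak{c}}(a)$ is a (finite) real number and \[ \rho_{\mathfrak{c}}(a)=-\inf\{\rho_{\mathfrak{c}^{op}}(b)\mid b\in H_{-k}(D_*),\ \underline{\Delta}(b,a)\neq 0\}. \] In particular, no discreteness of $\omega(\Gamma)\subset\mathbb{R}$ (rationality) is required. -/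

import Mathlib

/-- The data `(π : P → S, 𝒜, ω, gr, deg)` underlying a graded filtered Floer–Novikov complex.
The finitely generated abelian group `Γ` is written additively, and its action on `P` is a field
`act` (not a type class), because the opposite complex has another action on the same set. -/
structure FloerNovikovData (Γ P S : Type*) [AddCommGroup Γ] where
  fg : AddGroup.FG Γ
  finite_base : Finite S
  /-- The action of `Γ` on `P`. -/
  act : Γ → P → P
  zero_act : ∀ p, act 0 p = p
  add_act : ∀ g h p, act (g + h) p = act g (act h p)
  /-- The principal `Γ`-bundle `π : P → S`: a surjection whose fibres are the orbits of a free
  action. -/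
  proj : P → S
  proj_surjective : Function.Surjective proj
  proj_eq_iff : ∀ p q, proj p = proj q ↔ ∃ g, act g p = q
  act_free : ∀ g p, act g p = p → g = 0
  /-- The action functional `𝒜`. -/
  A : P → ℝ
  /-- The period homomorphism. -/
  ω : Γ →+ ℝ
  A_act : ∀ g p, A (act g p) = A p - ω g
  /-- The grading. -/
  gr : P → ℤ
  /-- The degree homomorphism. -/
  deg : Γ →+ ℤ
  gr_act : ∀ g p, gr (act g p) = gr p - deg g

/-- Arbitrary formal sums `∑ c_p p` with coefficients in `K`, encoded as the functions `p ↦ c_p`. -/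
def FormalSum (K P : Type*) := P → K

instance {K P : Type*} [Field K] : AddCommGroup (FormalSum K P) :=
  inferInstanceAs (AddCommGroup (P → K))

instance {K P : Type*} [Field K] : Module K (FormalSum K P) :=
  inferInstanceAs (Module K (P → K))

theorem FormalSum.sum_apply {K P ι : Type*} [Field K] (s : Finset ι) (f : ι → FormalSum K P)
    (p : P) : (∑ i ∈ s, f i) p = ∑ i ∈ s, f i p :=
  Finset.sum_apply (M := fun _ : P => K) p s f

namespace FloerNovikovData

variable {Γ P S : Type*} [AddCommGroup Γ] (X : FloerNovikovData Γ P S)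

theorem neg_act_act (g : Γ) (p : P) : X.act (-g) (X.act g p) = p := by
  rw [← X.add_act, neg_add_cancel, X.zero_act]

theorem act_neg_act (g : Γ) (p : P) : X.act g (X.act (-g) p) = p := by
  rw [← X.add_act, add_neg_cancel, X.zero_act]

theorem act_bijective (g : Γ) : Function.Bijective (X.act g) :=
  ⟨fun p q h => by rw [← X.neg_act_act g p, h, X.neg_act_act], fun p => ⟨_, X.act_neg_act g p⟩⟩

theorem act_left_injective (p : P) : Function.Injective fun g => X.act g p := by
  intro g h e
  have e' : X.act g p = X.act h p := e
  have : X.act (-h + g) p = p := by rw [X.add_act, e', X.neg_act_act]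
  have := X.act_free _ _ this
  rw [neg_add_eq_zero] at this
  exact this.symm

/-- The underlying data of the opposite complex. -/
def op : FloerNovikovData Γ P S where
  fg := X.fg
  finite_base := X.finite_base
  act g p := X.act (-g) p
  zero_act p := by rw [neg_zero, X.zero_act]
  add_act g h p := by rw [neg_add, X.add_act]
  proj := X.proj
  proj_surjective := X.proj_surjective
  proj_eq_iff p q := by
    rw [X.proj_eq_iff]
    exact ⟨fun ⟨g, h⟩ => ⟨-g, by rwa [neg_neg]⟩, fun ⟨g, h⟩ => ⟨-g, h⟩⟩
  act_free g p h := neg_eq_zero.mp (X.act_free _ _ h)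
  A p := -X.A p
  ω := X.ω
  A_act g p := by rw [X.A_act, map_neg]; ring
  gr p := -X.gr p
  deg := X.deg
  gr_act g p := by rw [X.gr_act, map_neg]; ring

variable (K : Type*) [Field K]

/-- The total Floer chain group `C_* = ⨁_k C_k`: the formal sums `∑ c_p p` that involve only finitely many gradings and, for every `C`, only finitely many
`p` with `𝒜(p) > C`. -/
def chains : Submodule K (FormalSum K P) where
  carrier := {c : P → K | (∀ C : ℝ, {p | c p ≠ 0 ∧ C < X.A p}.Finite) ∧
    (X.gr '' {p | c p ≠ 0}).Finite}
  zero_mem' := ⟨fun _ => Set.finite_empty.subset fun _ h => h.1 rfl,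
    Set.finite_empty.subset (by rintro _ ⟨_, h, rfl⟩; exact h rfl)⟩
  add_mem' := by
    intro a b ha hb
    have key : ∀ p, (a + b) p ≠ 0 → a p ≠ 0 ∨ b p ≠ 0 := by
      intro p h
      by_contra! h'
      exact h (by change a p + b p = 0; rw [h'.1, h'.2, add_zero])
    refine ⟨fun C => ((ha.1 C).union (hb.1 C)).subset ?_, (ha.2.union hb.2).subset ?_⟩
    · rintro p ⟨h, hC⟩
      exact (key p h).imp (⟨·, hC⟩) (⟨·, hC⟩)
    · rintro _ ⟨p, h, rfl⟩
      exact (key p h).imp (⟨p, ·, rfl⟩) (⟨p, ·, rfl⟩)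
  smul_mem' := by
    intro t a ha
    have key : ∀ p, (t • a) p ≠ 0 → a p ≠ 0 := fun p h => right_ne_zero_of_mul h
    exact ⟨fun C => (ha.1 C).subset fun p h => ⟨key p h.1, h.2⟩,
      ha.2.subset (Set.image_mono fun p h => key p h)⟩

/-- The degree-`k` part `C_k` of the Floer chain group. -/
def graded (k : ℤ) : Submodule K (X.chains K) where
  carrier := {c | ∀ p, c.1 p ≠ 0 → X.gr p = k}
  zero_mem' := fun _ h => absurd rfl h
  add_mem' := by
    intro a b ha hb p h
    by_cases h' : a.1 p = 0
    · refine hb p fun h'' => h ?_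
      change a.1 p + b.1 p = 0
      rw [h', h'', add_zero]
    · exact ha p h'
  smul_mem' := fun t a ha p h => ha p (right_ne_zero_of_mul (a := t) h)

/-- The Novikov ring `Λ̄ = ⨁_n e^n Λ`: the formal sums `∑ b_g g` that involve only finitely many degrees and, for every `C`, only finitely many `g` with `ω(g) < C`. -/
def novikov : Submodule K (FormalSum K Γ) where
  carrier := {b : Γ → K | (∀ C : ℝ, {g | b g ≠ 0 ∧ X.ω g < C}.Finite) ∧
    (X.deg '' {g | b g ≠ 0}).Finite}
  zero_mem' := ⟨fun _ => Set.finite_empty.subset fun _ h => h.1 rfl,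
    Set.finite_empty.subset (by rintro _ ⟨_, h, rfl⟩; exact h rfl)⟩
  add_mem' := by
    intro a b ha hb
    have key : ∀ p, (a + b) p ≠ 0 → a p ≠ 0 ∨ b p ≠ 0 := by
      intro p h
      by_contra! h'
      exact h (by change a p + b p = 0; rw [h'.1, h'.2, add_zero])
    refine ⟨fun C => ((ha.1 C).union (hb.1 C)).subset ?_, (ha.2.union hb.2).subset ?_⟩
    · rintro p ⟨h, hC⟩
      exact (key p h).imp (⟨·, hC⟩) (⟨·, hC⟩)
    · rintro _ ⟨p, h, rfl⟩
      exact (key p h).imp (⟨p, ·, rfl⟩) (⟨p, ·, rfl⟩)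
  smul_mem' := by
    intro t a ha
    have key : ∀ p, (t • a) p ≠ 0 → a p ≠ 0 := fun p h => right_ne_zero_of_mul h
    exact ⟨fun C => (ha.1 C).subset fun p h => ⟨key p h.1, h.2⟩,
      ha.2.subset (Set.image_mono fun p h => key p h)⟩

variable {K}

theorem chains_bddAbove (c : X.chains K) : ∃ M : ℝ, ∀ p, c.1 p ≠ 0 → X.A p ≤ M := by
  obtain ⟨M, hM⟩ := ((c.2.1 0).image X.A).bddAbove
  refine ⟨max M 0, fun p hp => ?_⟩
  by_cases h : 0 < X.A p
  · exact le_max_of_le_left (hM ⟨p, ⟨hp, h⟩, rfl⟩)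
  · exact le_max_of_le_right (not_lt.mp h)

theorem novikov_bddBelow (b : X.novikov K) : ∃ m : ℝ, ∀ g, b.1 g ≠ 0 → m ≤ X.ω g := by
  obtain ⟨m, hm⟩ := ((b.2.1 0).image X.ω).bddBelow
  refine ⟨min m 0, fun g hg => ?_⟩
  by_cases h : X.ω g < 0
  · exact min_le_of_left_le (hm ⟨g, ⟨hg, h⟩, rfl⟩)
  · exact min_le_of_right_le (not_lt.mp h)

theorem exists_ne_zero_of_finsum {ι : Type*} {f : ι → K} (h : ∑ᶠ i, f i ≠ 0) :
    ∃ i, f i ≠ 0 := by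
  by_contra! h'
  exact h (by simp [h'])

/-- The action of `Λ̄` on `C_*` induced by the action of `Γ` on `P`:
`(∑ b_g g) (∑ c_q q) = ∑ b_g c_q (g · q)`. The sum is finite for each `p`. -/
noncomputable def novikovSMul (b : X.novikov K) (c : X.chains K) : X.chains K :=
  ⟨fun p => ∑ᶠ g, b.1 g * c.1 (X.act (-g) p), by
    have key : ∀ p, ∑ᶠ g, b.1 g * c.1 (X.act (-g) p) ≠ 0 →
        ∃ g q, b.1 g ≠ 0 ∧ c.1 q ≠ 0 ∧ p = X.act g q := by
      intro p h
      obtain ⟨g, hg⟩ := exists_ne_zero_of_finsum h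
      exact ⟨g, _, left_ne_zero_of_mul hg, right_ne_zero_of_mul hg, (X.act_neg_act g p).symm⟩
    obtain ⟨M, hM⟩ := X.chains_bddAbove c
    obtain ⟨m, hm⟩ := X.novikov_bddBelow b
    refine ⟨fun C => ?_, ?_⟩
    · refine (((b.2.1 (M - C)).prod (c.2.1 (C + m))).image fun x => X.act x.1 x.2).subset ?_
      rintro p ⟨h, hC⟩
      obtain ⟨g, q, hg, hq, rfl⟩ := key p h
      rw [X.A_act] at hC
      have := hM q hq
      have := hm g hg
      exact ⟨(g, q), ⟨⟨hg, by linarith⟩, ⟨hq, by linarith⟩⟩, rfl⟩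
    · refine ((b.2.2.prod c.2.2).image fun x => x.2 - x.1).subset ?_
      rintro _ ⟨p, h, rfl⟩
      obtain ⟨g, q, hg, hq, rfl⟩ := key p h
      exact ⟨(X.deg g, X.gr q), ⟨⟨g, hg, rfl⟩, ⟨q, hq, rfl⟩⟩, (X.gr_act g q).symm⟩⟩

/-- The filtration level `ℓ(∑ c_p p) = max {𝒜(p) | c_p ≠ 0}`, with `ℓ(0) = -∞`. The supremum
of a nonzero chain is attained, see `exists_level_eq`. -/
noncomputable def level (c : X.chains K) : EReal := ⨆ p : {p : P // c.1 p ≠ 0}, (X.A p.1 : EReal)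

theorem le_level (c : X.chains K) {p : P} (hp : c.1 p ≠ 0) : (X.A p : EReal) ≤ X.level c :=
  le_iSup (fun p : {p : P // c.1 p ≠ 0} => (X.A p.1 : EReal)) ⟨p, hp⟩

theorem exists_level_eq (c : X.chains K) (hc : c ≠ 0) :
    ∃ p, c.1 p ≠ 0 ∧ X.level c = X.A p := by
  obtain ⟨p₀, hp₀⟩ : ∃ p, c.1 p ≠ 0 := by
    by_contra! h
    exact hc (Subtype.ext (funext h))
  obtain ⟨p, hp, hmax⟩ := Set.exists_max_image {p | c.1 p ≠ 0 ∧ X.A p₀ - 1 < X.A p} X.A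
    (c.2.1 _) ⟨p₀, hp₀, by linarith⟩
  refine ⟨p, hp.1, le_antisymm (iSup_le ?_) (X.le_level c hp.1)⟩
  rintro ⟨q, hq⟩
  rw [EReal.coe_le_coe_iff]
  by_cases h : X.A p₀ - 1 < X.A q
  · exact hmax q ⟨hq, h⟩
  · have := hp.2
    exact (not_lt.mp h).trans this.le

open Classical in
/-- The generator `p ∈ P` as a chain. -/
noncomputable def gen (K : Type*) [Field K] (p : P) : X.chains K :=
  ⟨Pi.single p 1, by
    have key : ∀ q, (Pi.single p 1 : P → K) q ≠ 0 → q = p := by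
      intro q h
      by_contra h'
      exact h (Pi.single_eq_of_ne h' _)
    exact ⟨fun C => (Set.finite_singleton p).subset fun q h => key q h.1,
      (Set.finite_singleton (X.gr p)).subset (by
        rintro _ ⟨q, h, rfl⟩
        rw [key q h]; rfl)⟩⟩

open Classical in
/-- The group element `g ∈ Γ` as an element of the Novikov ring. -/
noncomputable def novikovGen (K : Type*) [Field K] (g : Γ) : X.novikov K :=
  ⟨Pi.single g 1, by
    have key : ∀ q, (Pi.single g 1 : Γ → K) q ≠ 0 → q = g := by
      intro q h
      by_contra h'
      exact h (Pi.single_eq_of_ne h' _)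
    exact ⟨fun C => (Set.finite_singleton g).subset fun q h => key q h.1,
      (Set.finite_singleton (X.deg g)).subset (by
        rintro _ ⟨q, h, rfl⟩
        rw [key q h]; rfl)⟩⟩

theorem gen_self (p : P) : (X.gen K p).1 p = 1 := by
  classical
  simp [gen]

theorem eq_of_gen_ne_zero {p q : P} (h : (X.gen K p).1 q ≠ 0) : q = p := by
  classical
  by_contra h'
  exact h (by simp [gen, h'])

theorem novikovGen_smul (g : Γ) (c : X.chains K) (p : P) :
    (X.novikovSMul (X.novikovGen K g) c).1 p = c.1 (X.act (-g) p) := by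
  classical
  change ∑ᶠ h, (Pi.single g 1 : Γ → K) h * c.1 (X.act (-h) p) = _
  rw [finsum_eq_single _ g]
  · simp
  · intro h hh
    simp [hh]

theorem novikovGen_smul_gen (g : Γ) (p : P) :
    X.novikovSMul (X.novikovGen K g) (X.gen K p) = X.gen K (X.act g p) := by
  classical
  refine Subtype.ext (funext fun q => ?_)
  rw [novikovGen_smul]
  by_cases h : q = X.act g p
  · rw [h, X.neg_act_act, gen_self, gen_self]
  · have h' : X.act (-g) q ≠ p := fun e => h (by rw [← e, X.act_neg_act])
    rw [not_imp_comm.mp X.eq_of_gen_ne_zero h', not_imp_comm.mp X.eq_of_gen_ne_zero h]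

theorem gen_ne_zero (p : P) : X.gen K p ≠ 0 := by
  intro h
  have := X.gen_self (K := K) p
  rw [h] at this
  exact zero_ne_one this

theorem finsum_swap {ι κ : Type*} (f : ι → κ → K)
    (h : {x : ι × κ | f x.1 x.2 ≠ 0}.Finite) :
    ∑ᶠ i, ∑ᶠ j, f i j = ∑ᶠ j, ∑ᶠ i, f i j := by
  have h' : {x : κ × ι | f x.2 x.1 ≠ 0}.Finite :=
    (h.image Prod.swap).subset fun x hx => ⟨x.swap, hx, rfl⟩
  rw [← finsum_curry (fun x : ι × κ => f x.1 x.2) h,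
    ← finsum_curry (fun x : κ × ι => f x.2 x.1) h']
  exact finsum_eq_of_bijective Prod.swap Prod.swap_bijective fun _ => rfl

end FloerNovikovData

/-- A graded filtered Floer–Novikov complex over the field `K`. -/
structure FloerNovikovComplex (K Γ P S : Type*) [Field K] [AddCommGroup Γ] extends
    FloerNovikovData Γ P S where
  /-- The Floer boundary operator `∂`, an endomorphism of the `Λ̄`-module `C_*`. -/
  d : toFloerNovikovData.chains K →ₗ[K] toFloerNovikovData.chains K
  d_novikovSMul : ∀ (b : toFloerNovikovData.novikov K) (c : toFloerNovikovData.chains K),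
    d (toFloerNovikovData.novikovSMul b c) = toFloerNovikovData.novikovSMul b (d c)
  d_d : ∀ c, d (d c) = 0
  level_d_lt : ∀ c, c ≠ 0 → toFloerNovikovData.level (d c) < toFloerNovikovData.level c
  d_mem_graded : ∀ k, ∀ c ∈ toFloerNovikovData.graded K k, d c ∈ toFloerNovikovData.graded K (k - 1)

namespace FloerNovikovComplex

open FloerNovikovData

variable {K Γ P S : Type*} [Field K] [AddCommGroup Γ] (X : FloerNovikovComplex K Γ P S)

/-- The matrix coefficients of the boundary operator: `∂ p = ∑ n(p, q) q`. -/
noncomputable def n (p q : P) : K := (X.d (X.gen K p)).1 q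

theorem n_act (g : Γ) (p q : P) : X.n (X.act g p) (X.act g q) = X.n p q := by
  unfold n
  rw [← X.novikovGen_smul_gen, X.d_novikovSMul, X.novikovGen_smul, X.neg_act_act]

theorem n_act_left (g : Γ) (p q : P) : X.n (X.act g p) q = X.n p (X.act (-g) q) := by
  rw [← X.n_act g p, X.act_neg_act]

theorem A_lt_of_n {p q : P} (h : X.n p q ≠ 0) : X.A q < X.A p := by
  have h1 := X.le_level _ h
  have h2 := X.level_d_lt _ (X.gen_ne_zero (K := K) p)
  obtain ⟨r, hr, e⟩ := X.exists_level_eq _ (X.gen_ne_zero (K := K) p)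
  rw [X.eq_of_gen_ne_zero hr] at e
  rw [e] at h2
  exact EReal.coe_lt_coe_iff.mp (h1.trans_lt h2)

theorem gr_of_n {p q : P} (h : X.n p q ≠ 0) : X.gr q = X.gr p - 1 :=
  X.d_mem_graded (X.gr p) (X.gen K p) (fun r hr => by rw [X.eq_of_gen_ne_zero hr]) q h

theorem finite_n_right (p : P) (C : ℝ) : {q | X.n p q ≠ 0 ∧ C < X.A q}.Finite :=
  (X.d (X.gen K p)).2.1 C

/-- A section of the bundle. -/
noncomputable def sec (s : S) : P := (X.proj_surjective s).choose

theorem proj_sec (s : S) : X.proj (X.sec s) = s := (X.proj_surjective s).choose_spec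

theorem sec_bijective : Function.Bijective fun x : S × Γ => X.act x.2 (X.sec x.1) := by
  constructor
  · rintro ⟨s, g⟩ ⟨t, h⟩ e
    have e' : X.act g (X.sec s) = X.act h (X.sec t) := e
    have hp : ∀ g p, X.proj (X.act g p) = X.proj p := fun g p =>
      ((X.proj_eq_iff p _).mpr ⟨g, rfl⟩).symm
    have hst : s = t := by
      have := congrArg X.proj e'
      rwa [hp, hp, X.proj_sec, X.proj_sec] at this
    subst hst
    rw [X.act_left_injective _ e']
  · intro p
    obtain ⟨g, hg⟩ := (X.proj_eq_iff (X.sec (X.proj p)) p).mp (X.proj_sec _)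
    exact ⟨(X.proj p, g), hg⟩

theorem finite_n_left (q : P) (C : ℝ) : {p | X.n p q ≠ 0 ∧ X.A p < C}.Finite := by
  have := X.finite_base
  have hfin : ∀ s, {g | X.n (X.sec s) (X.act (-g) q) ≠ 0 ∧
      X.A q + X.A (X.sec s) - C < X.A (X.act (-g) q)}.Finite := fun s =>
    (X.finite_n_right (X.sec s) (X.A q + X.A (X.sec s) - C)).preimage
      (((X.act_left_injective q).comp neg_injective).injOn)
  refine (Set.finite_iUnion fun s => (hfin s).image fun g => X.act g (X.sec s)).subset ?_
  rintro p ⟨h, hC⟩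
  obtain ⟨⟨s, g⟩, rfl⟩ := X.sec_bijective.2 p
  dsimp only at h hC
  rw [X.n_act_left] at h
  rw [X.A_act] at hC
  exact Set.mem_iUnion.mpr ⟨s, g, ⟨h, by rw [X.A_act, map_neg]; linarith⟩, rfl⟩

/-- The coefficients of a chain along one fibre of the bundle, as a Novikov ring element. -/
noncomputable def coeffs (c : X.chains K) (s : S) : X.novikov K :=
  ⟨fun g => c.1 (X.act g (X.sec s)), by
    constructor
    · intro C
      refine ((c.2.1 (X.A (X.sec s) - C)).preimage (X.act_left_injective (X.sec s)).injOn).subset ?_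
      rintro g ⟨h, hC⟩
      exact ⟨h, by rw [X.A_act]; linarith⟩
    · refine (c.2.2.image fun k => X.gr (X.sec s) - k).subset ?_
      rintro _ ⟨g, h, rfl⟩
      exact ⟨_, ⟨_, h, rfl⟩, by rw [X.gr_act]; ring⟩⟩

theorem chain_eq_sum [Fintype S] (c : X.chains K) :
    c = ∑ s, X.novikovSMul (X.coeffs c s) (X.gen K (X.sec s)) := by
  classical
  refine Subtype.ext (funext fun p => ?_)
  rw [AddSubmonoidClass.coe_finsetSum, FormalSum.sum_apply]
  obtain ⟨⟨s, g⟩, rfl⟩ := X.sec_bijective.2 p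
  dsimp only
  have key : ∀ t h, (X.gen K (X.sec t)).1 (X.act (-h) (X.act g (X.sec s))) ≠ 0 →
      (s, g) = (t, h) := by
    intro t h hne
    have := X.eq_of_gen_ne_zero hne
    refine X.sec_bijective.1 ?_
    dsimp only
    rw [← this, X.act_neg_act]
  rw [Finset.sum_eq_single s]
  · change _ = ∑ᶠ h, c.1 (X.act h (X.sec s)) * _
    rw [finsum_eq_single _ g]
    · rw [X.neg_act_act, X.gen_self, mul_one]
    · intro h hh
      rw [not_imp_comm.mp (key s h) fun e => hh (Prod.ext_iff.mp e).2.symm, mul_zero]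
  · intro t _ ht
    change ∑ᶠ h, c.1 (X.act h (X.sec t)) * _ = 0
    rw [finsum_eq_single _ 0, not_imp_comm.mp (key t 0), mul_zero]
    · exact fun e => ht (Prod.ext_iff.mp e).1.symm
    · intro h _
      rw [not_imp_comm.mp (key t h) fun e => ht (Prod.ext_iff.mp e).1.symm, mul_zero]
  · simp

theorem finite_d_support (c : X.chains K) (q : P) : {p | c.1 p * X.n p q ≠ 0}.Finite :=
  (c.2.1 (X.A q)).subset fun _ h =>
    ⟨left_ne_zero_of_mul h, X.A_lt_of_n (right_ne_zero_of_mul h)⟩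

/-- The boundary operator is determined by its matrix coefficients. -/
theorem d_apply (c : X.chains K) (q : P) : (X.d c).1 q = ∑ᶠ p, c.1 p * X.n p q := by
  classical
  have := X.finite_base
  have := Fintype.ofFinite S
  conv_lhs => rw [X.chain_eq_sum c]
  rw [map_sum, AddSubmonoidClass.coe_finsetSum, FormalSum.sum_apply,
    ← finsum_comp (fun x : S × Γ => X.act x.2 (X.sec x.1)) X.sec_bijective, finsum_curry,
    finsum_eq_sum_of_fintype]
  · refine Finset.sum_congr rfl fun s _ => ?_
    rw [X.d_novikovSMul]
    refine finsum_congr fun g => ?_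
    rw [X.n_act_left]
    rfl
  · exact (X.finite_d_support c q).preimage X.sec_bijective.1.injOn

/-- The opposite boundary operator `δ`, the `Λ̄`-linear extension of `δ p = ∑ n(q, p) q`. -/
noncomputable def opD : X.op.chains K →ₗ[K] X.op.chains K where
  toFun c := ⟨fun q => ∑ᶠ p, c.1 p * X.n q p, by
    have key : ∀ q, ∑ᶠ p, c.1 p * X.n q p ≠ 0 → ∃ p, c.1 p ≠ 0 ∧ X.n q p ≠ 0 := by
      intro q h
      obtain ⟨p, hp⟩ := exists_ne_zero_of_finsum h
      exact ⟨p, left_ne_zero_of_mul hp, right_ne_zero_of_mul hp⟩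
    constructor
    · intro C
      refine ((c.2.1 C).biUnion fun p _ => X.finite_n_left p (-C)).subset ?_
      rintro q ⟨h, hC⟩
      obtain ⟨p, hp, hn⟩ := key q h
      have h1 := X.A_lt_of_n hn
      have hC' : C < -X.A q := hC
      exact Set.mem_biUnion (x := p) ⟨hp, show C < -X.A p by linarith⟩ ⟨hn, by linarith⟩
    · refine (c.2.2.image fun k => k - 1).subset ?_
      rintro _ ⟨q, h, rfl⟩
      obtain ⟨p, hp, hn⟩ := key q h
      refine ⟨_, ⟨p, hp, rfl⟩, ?_⟩
      change -X.gr p - 1 = -X.gr q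
      rw [X.gr_of_n hn]; ring⟩
  map_add' := by
    intro a b
    refine Subtype.ext (funext fun q => ?_)
    have hf : ∀ c : X.op.chains K, {p | c.1 p * X.n q p ≠ 0}.Finite := fun c =>
      (c.2.1 (-X.A q)).subset fun p h =>
        ⟨left_ne_zero_of_mul h, neg_lt_neg (X.A_lt_of_n (right_ne_zero_of_mul h))⟩
    change ∑ᶠ p, (a.1 p + b.1 p) * X.n q p = (∑ᶠ p, a.1 p * X.n q p) + ∑ᶠ p, b.1 p * X.n q p
    rw [← finsum_add_distrib (hf a) (hf b)]
    simp only [add_mul]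
  map_smul' := by
    intro t a
    refine Subtype.ext (funext fun q => ?_)
    change ∑ᶠ p, t * a.1 p * X.n q p = t * ∑ᶠ p, a.1 p * X.n q p
    rw [mul_finsum]
    simp only [mul_assoc]

theorem opD_apply (c : X.op.chains K) (q : P) : (X.opD c).1 q = ∑ᶠ p, c.1 p * X.n q p := rfl

theorem exists_of_opD {c : X.op.chains K} {q : P} (h : (X.opD c).1 q ≠ 0) :
    ∃ p, c.1 p ≠ 0 ∧ X.n q p ≠ 0 := by
  rw [opD_apply] at h
  obtain ⟨p, hp⟩ := exists_ne_zero_of_finsum h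
  exact ⟨p, left_ne_zero_of_mul hp, right_ne_zero_of_mul hp⟩

/-- The opposite complex. -/
noncomputable def op : FloerNovikovComplex K Γ P S where
  toFloerNovikovData := X.toFloerNovikovData.op
  d := X.opD
  d_novikovSMul := by
    intro b c
    refine Subtype.ext (funext fun q => ?_)
    change ∑ᶠ p, (∑ᶠ g, b.1 g * c.1 (X.act (- -g) p)) * X.n q p =
      ∑ᶠ g, b.1 g * ∑ᶠ p, c.1 p * X.n (X.act (- -g) q) p
    simp only [neg_neg, finsum_mul, mul_finsum]
    rw [finsum_swap]
    · refine finsum_congr fun g => ?_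
      refine finsum_eq_of_bijective (X.act g) (X.act_bijective g) fun p => ?_
      rw [X.n_act, mul_assoc]
    · obtain ⟨M, hM⟩ := X.toFloerNovikovData.op.chains_bddAbove c
      obtain ⟨m, hm⟩ := X.toFloerNovikovData.op.novikov_bddBelow b
      refine (((b.2.1 (X.A q + M)).prod (c.2.1 (m - X.A q))).image
        fun x => (X.act (-x.1) x.2, x.1)).subset ?_
      rintro ⟨p, g⟩ h
      have hn := X.A_lt_of_n (right_ne_zero_of_mul h)
      have hb : b.1 g ≠ 0 := left_ne_zero_of_mul (left_ne_zero_of_mul h)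
      have hc : c.1 (X.act g p) ≠ 0 := right_ne_zero_of_mul (left_ne_zero_of_mul h)
      have h1 : -X.A (X.act g p) ≤ M := hM _ hc
      have h2 : m ≤ X.ω g := hm g hb
      have h3 := X.A_act g p
      refine ⟨(g, X.act g p), ⟨⟨hb, show X.ω g < X.A q + M by linarith⟩,
        ⟨hc, show m - X.A q < -X.A (X.act g p) by linarith⟩⟩, ?_⟩
      dsimp only
      rw [X.neg_act_act]
  d_d := by
    intro c
    refine Subtype.ext (funext fun r => ?_)
    change ∑ᶠ q, (∑ᶠ p, c.1 p * X.n q p) * X.n r q = 0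
    simp only [finsum_mul]
    rw [finsum_swap]
    · have key : ∀ p, ∑ᶠ q, X.n r q * X.n q p = 0 := by
        intro p
        have h := X.d_apply (X.d (X.gen K r)) p
        rw [X.d_d] at h
        exact h.symm
      have : ∀ p, ∑ᶠ q, c.1 p * X.n q p * X.n r q = 0 := by
        intro p
        rw [← mul_zero (c.1 p), ← key p, mul_finsum]
        exact finsum_congr fun q => by ring
      simp only [this, finsum_zero]
    · refine ((c.2.1 (-X.A r)).biUnion fun p _ =>
        (X.finite_n_left p (X.A r)).image fun q => (q, p)).subset ?_
      rintro ⟨q, p⟩ h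
      have hc : c.1 p ≠ 0 := left_ne_zero_of_mul (left_ne_zero_of_mul h)
      have hn : X.n q p ≠ 0 := right_ne_zero_of_mul (left_ne_zero_of_mul h)
      have h1 := X.A_lt_of_n hn
      have h2 := X.A_lt_of_n (right_ne_zero_of_mul h)
      exact Set.mem_biUnion (x := p) ⟨hc, neg_lt_neg (h1.trans h2)⟩ ⟨q, ⟨hn, h2⟩, rfl⟩
  level_d_lt := by
    intro c hc
    obtain ⟨p₀, hp₀, e₀⟩ := X.toFloerNovikovData.op.exists_level_eq c hc
    by_cases h : X.opD c = 0
    · rw [h, e₀]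
      refine lt_of_eq_of_lt ?_ (EReal.bot_lt_coe _)
      exact iSup_eq_bot.mpr fun p => absurd rfl p.2
    · obtain ⟨q, hq, e⟩ := X.toFloerNovikovData.op.exists_level_eq _ h
      obtain ⟨p, hp, hn⟩ := X.exists_of_opD hq
      rw [e]
      refine lt_of_lt_of_le ?_ (X.toFloerNovikovData.op.le_level c hp)
      exact EReal.coe_lt_coe_iff.mpr (neg_lt_neg (X.A_lt_of_n hn))
  d_mem_graded := by
    intro k c hc q hq
    obtain ⟨p, hp, hn⟩ := X.exists_of_opD hq
    have h1 : -X.gr p = k := hc p hp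
    change -X.gr q = k - 1
    rw [← h1, X.gr_of_n hn]; ring

/-- The degree-`k` cycles. -/
def cycles (k : ℤ) : Submodule K (X.chains K) := X.graded K k ⊓ LinearMap.ker X.d

/-- The degree-`k` boundaries `∂ C_{k+1}`, inside the cycles. -/
def boundaries (k : ℤ) : Submodule K (X.cycles k) :=
  ((X.graded K (k + 1)).map X.d).submoduleOf (X.cycles k)

/-- The homology `H_k(C_*)`. -/
abbrev homology (k : ℤ) := X.cycles k ⧸ X.boundaries k

/-- The spectral number `ρ(a) = inf {ℓ(c) | [c] = a}`. -/
noncomputable def spectralNumber {k : ℤ} (a : X.homology k) : EReal :=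
  ⨅ c : {c : X.cycles k // (X.boundaries k).mkQ c = a}, X.level c.1.1

theorem finite_pairing_support (d : X.op.chains K) (c : X.chains K) :
    {p | d.1 p * c.1 p ≠ 0}.Finite := by
  obtain ⟨M, hM⟩ := X.toFloerNovikovData.op.chains_bddAbove d
  refine (c.2.1 (-M - 1)).subset fun p h => ⟨right_ne_zero_of_mul h, ?_⟩
  have : -X.A p ≤ M := hM p (left_ne_zero_of_mul h)
  linarith

/-- The pairing `Δ(∑ d_p p, ∑ c_p p) = ∑ d_p c_p` between `D_*` and `C_*`. -/
noncomputable def pairing : X.op.chains K →ₗ[K] X.chains K →ₗ[K] K :=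
  LinearMap.mk₂ K (fun d c => ∑ᶠ p, d.1 p * c.1 p)
    (fun d d' c => by
      rw [← finsum_add_distrib (X.finite_pairing_support d c) (X.finite_pairing_support d' c)]
      exact finsum_congr fun p => add_mul _ _ _)
    (fun t d c => by
      rw [smul_eq_mul, mul_finsum]
      exact finsum_congr fun p => mul_assoc _ _ _)
    (fun d c c' => by
      rw [← finsum_add_distrib (X.finite_pairing_support d c) (X.finite_pairing_support d c')]
      exact finsum_congr fun p => mul_add _ _ _)
    (fun t d c => by
      rw [smul_eq_mul, mul_finsum]
      exact finsum_congr fun p => mul_left_comm _ _ _)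

theorem pairing_apply (d : X.op.chains K) (c : X.chains K) :
    X.pairing d c = ∑ᶠ p, d.1 p * c.1 p := rfl

theorem pairing_d (d : X.op.chains K) (c : X.chains K) :
    X.pairing (X.op.d d) c = X.pairing d (X.d c) := by
  rw [pairing_apply, pairing_apply]
  simp only [X.d_apply]
  change ∑ᶠ q, (∑ᶠ p, d.1 p * X.n q p) * c.1 q = _
  simp only [finsum_mul, mul_finsum]
  rw [finsum_swap]
  · exact finsum_congr fun p => finsum_congr fun q => by ring
  · obtain ⟨M, hM⟩ := X.toFloerNovikovData.op.chains_bddAbove d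
    obtain ⟨M', hM'⟩ := X.chains_bddAbove c
    refine ((c.2.1 (-M)).prod (d.2.1 (-M'))).subset ?_
    rintro ⟨q, p⟩ h
    have hc : c.1 q ≠ 0 := right_ne_zero_of_mul h
    have hd : d.1 p ≠ 0 := left_ne_zero_of_mul (left_ne_zero_of_mul h)
    have h1 := X.A_lt_of_n (right_ne_zero_of_mul (left_ne_zero_of_mul h))
    have h2 : -X.A p ≤ M := hM p hd
    have h3 := hM' q hc
    exact ⟨⟨hc, by linarith⟩, ⟨hd, show -M' < -X.A p by linarith⟩⟩

/-- The pairing of a cycle of the opposite complex with homology classes. -/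
noncomputable def cyclePairing (k : ℤ) : X.op.cycles (-k) →ₗ[K] X.homology k →ₗ[K] K where
  toFun d := (X.boundaries k).liftQ ((X.pairing d.1).comp (X.cycles k).subtype) (by
    rintro ⟨_, hc⟩ ⟨x, _, rfl⟩
    change X.pairing d.1 (X.d x) = 0
    have hd : X.op.d d.1 = 0 := d.2.2
    rw [← X.pairing_d, hd, map_zero, LinearMap.zero_apply])
  map_add' d d' := by
    ext c
    exact LinearMap.map_add₂ X.pairing d.1 d'.1 c.1
  map_smul' t d := by
    ext c
    exact LinearMap.map_smul₂ X.pairing t d.1 c.1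

/-- The pairing `H_{-k}(D_*) × H_k(C_*) → K` induced by `Δ`. -/
noncomputable def homologyPairing (k : ℤ) : X.op.homology (-k) →ₗ[K] X.homology k →ₗ[K] K :=
  (X.op.boundaries (-k)).liftQ (X.cyclePairing k) (by
    rintro ⟨_, hd⟩ ⟨x, _, rfl⟩
    refine LinearMap.mem_ker.mpr ?_
    ext c
    change X.pairing (X.op.d x) c.1 = 0
    have hc : X.d c.1 = 0 := c.2.2
    rw [X.pairing_d, hc, map_zero])

theorem homologyPairing_mk (k : ℤ) (d : X.op.cycles (-k)) (c : X.cycles k) :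
    X.homologyPairing k ((X.op.boundaries (-k)).mkQ d) ((X.boundaries k).mkQ c) =
      ∑ᶠ p, d.1.1 p * c.1.1 p := rfl

end FloerNovikovComplex

/-! Let `G = ω(ker deg)`. The Hahn series over `G` with finitely many terms below every real number
form a field `Λ`. As `ω` is injective on `ker deg`, this field acts on `C_k`, and choosing one point
of grading `k` in each fibre that has one makes `C_k` a finite-dimensional `Λ`-space on which `exp
ℓ` is a maximum norm with weights `exp 𝒜`. The boundaries form a `Λ`-subspace `U`.

One inequality is elementary: `Δ(d, c) ≠ 0` forces a common generator in the supports of `d` and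
`c`, so `-ℓ(d) ≤ ℓ(c)`. For the other, `exists_functional_and_best_approximation`, applied to a
cycle `c` in the class `a`, gives a representative `c'` of `a` and a functional `φ` with `φ = 0` on
`U`, `φ(c) = 1` and `|φ(x)| ‖c'‖ ≤ ‖x‖`. The constant term of `φ` is `Δ(d, ·)` for a cycle `d` of
the opposite complex (`pairing_dualChain`, `exists_dual_cycle`), and the bound on generators becomes
`ℓ(c') ≤ -ℓ(d)`. Hence `ρ(a) ≤ ℓ(c') ≤ -ℓ(d) ≤ -ρ([d]) ≤ -inf ≤ ρ(a)`, with equality throughout, and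
finiteness follows.

Rationality plays no role because the Hahn–Banach step is Gaussian elimination with pivots of
maximal weighted size: it uses finite dimension, but neither a discrete valuation nor completeness.
-/

open scoped NNReal

/-! ### Non-Archimedean Hahn–Banach by pivoting -/

/-- Non-Archimedean Hahn–Banach with an exact norm and a best approximation, for a subspace of a
finite-dimensional space with a weighted maximum norm. -/
theorem exists_functional_and_best_approximation {F Γ₀ ι : Type*} [Field F]
    [LinearOrderedCommGroupWithZero Γ₀] [Finite ι] (v : Valuation F Γ₀) (w : ι → Γ₀)
    (hw : ∀ i, w i ≠ 0) (U : Submodule F (ι → F)) (c : ι → F) (hc : c ∉ U) :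
    ∃ c' : ι → F, c' - c ∈ U ∧ ∃ φ : (ι → F) →ₗ[F] F, (∀ x ∈ U, φ x = 0) ∧ φ c = 1 ∧
      ∀ (x : ι → F) (M : Γ₀), (∀ i, v (x i) * w i ≤ M) →
        ∀ i, v (φ x) * (v (c' i) * w i) ≤ M := by
  have pivot : ∀ u : ι → F, u ≠ 0 → ∃ i, u i ≠ 0 ∧ ∀ j, v (u j) * w j ≤ v (u i) * w i := by
    intro u hu
    obtain ⟨j, hj⟩ := Function.ne_iff.mp hu
    have : Nonempty ι := ⟨j⟩
    obtain ⟨i, hi⟩ := Finite.exists_max fun i => v (u i) * w i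
    refine ⟨i, fun h => ?_, hi⟩
    have := hi j
    rw [h, map_zero, zero_mul, le_zero_iff, mul_eq_zero, map_eq_zero] at this
    exact this.elim hj (hw j)
  induction hn : Module.finrank F U using Nat.strong_induction_on generalizing U c with
  | _ n ih =>
  subst hn
  by_cases hU : U = ⊥
  -- Here `c` is its own best approximation, and `φ` reads off the coordinate that carries the norm
  -- of `c`, rescaled.
  · subst hU
    obtain ⟨i, hi, hmax⟩ := pivot c hc
    refine ⟨c, by simp, (c i)⁻¹ • LinearMap.proj i, by simp, by simp [hi], fun x M hx j => ?_⟩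
    calc v (((c i)⁻¹ • LinearMap.proj (R := F) (φ := fun _ => F) i) x) * (v (c j) * w j)
        ≤ v ((c i)⁻¹ * x i) * (v (c i) * w i) := mul_le_mul_right (hmax j) _
      _ = v (x i) * w i := by
        rw [← mul_assoc, ← map_mul]
        congr 2
        field_simp
      _ ≤ M := hx i
  · obtain ⟨u, huU, hu⟩ := Submodule.exists_mem_ne_zero_of_ne_bot hU
    obtain ⟨i, hi, hmax⟩ := pivot u hu
    -- `Q` clears coordinate `i` by subtracting a multiple of `u`. Since `i` carries the norm of
    -- `u`, that multiple is no larger than `x`, so `Q` does not increase the norm. This reduces the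
    -- problem to `V`, of smaller dimension, and to the vector `Q c`.
    let Q : (ι → F) →ₗ[F] (ι → F) :=
      LinearMap.id - ((u i)⁻¹ • LinearMap.proj (R := F) (φ := fun _ => F) i).smulRight u
    have hQ : ∀ x, Q x = x - ((u i)⁻¹ * x i) • u := fun x => rfl
    have hQU : ∀ x, Q x - x ∈ U := fun x => by
      rw [hQ, sub_sub_cancel_left]
      exact U.neg_mem (U.smul_mem _ huU)
    let V : Submodule F (ι → F) := U ⊓ LinearMap.ker (LinearMap.proj (R := F) (φ := fun _ => F) i)
    have hVU : V < U := lt_of_le_of_ne inf_le_left fun h => hi (h.ge huU).2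
    have hQV : ∀ x ∈ U, Q x ∈ V := fun x hx => by
      refine ⟨by simpa using U.add_mem (hQU x) hx, ?_⟩
      simp [hQ, hi, mul_comm (u i)⁻¹]
    have hcV : Q c ∉ V := fun h => hc (by simpa using U.sub_mem h.1 (hQU c))
    obtain ⟨c', hc', φ, hφ, hφc, hle⟩ := ih _ (Submodule.finrank_lt_finrank_of_lt hVU) V _ hcV rfl
    refine ⟨c', by simpa using U.add_mem hc'.1 (hQU c), φ.comp Q, fun x hx => hφ _ (hQV x hx), hφc,
      fun x M hx j => hle (Q x) M (fun l => ?_) j⟩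
    have h1 : v (((u i)⁻¹ * x i) * u l) * w l ≤ M := calc
      _ = v ((u i)⁻¹ * x i) * (v (u l) * w l) := by rw [map_mul, mul_assoc]
      _ ≤ v ((u i)⁻¹ * x i) * (v (u i) * w i) := mul_le_mul_right (hmax l) _
      _ = v (x i) * w i := by
        rw [← mul_assoc, ← map_mul]
        congr 2
        field_simp
      _ ≤ M := hx i
    have h2 : v (Q x l) ≤ max (v (x l)) (v (((u i)⁻¹ * x i) * u l)) := v.map_sub _ _
    rcases le_max_iff.mp h2 with h | h
    · exact (mul_le_mul_left h _).trans (hx l)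
    · exact (mul_le_mul_left h _).trans h1

/-! ### The valued field of left-finite Hahn series -/

namespace HahnSeries

/-- Puts the product in the convolution form of `novikovSMul`, so that the two can be compared term
by term. -/
theorem coeff_mul_eq_finsum {G R : Type*} [AddCommGroup G] [LinearOrder G] [IsOrderedAddMonoid G]
    [Field R] (x y : HahnSeries G R) (a : G) :
    (x * y).coeff a = ∑ᶠ i, x.coeff i * y.coeff (a - i) := by
  rw [coeff_mul]
  have hinj : Set.InjOn Prod.fst
      (Finset.antidiagonal x.isPWO_support y.isPWO_support a : Set (G × G)) := by
    rintro ⟨i, j⟩ h ⟨i', j'⟩ h' (e : i = i')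
    have h1 := (Finset.mem_antidiagonal.mp h).2.2
    have h2 := (Finset.mem_antidiagonal.mp h').2.2
    subst e
    simpa using h1.trans h2.symm
  classical
  rw [finsum_eq_sum_of_support_subset (s :=
    (Finset.antidiagonal x.isPWO_support y.isPWO_support a).image Prod.fst), Finset.sum_image hinj]
  · refine Finset.sum_congr rfl fun ij h => ?_
    rw [← (Finset.mem_antidiagonal.mp h).2.2, add_sub_cancel_left]
  · intro i hi
    rw [Finset.mem_coe, Finset.mem_image]
    exact ⟨(i, a - i), Finset.mem_antidiagonal.mpr
      ⟨left_ne_zero_of_mul hi, right_ne_zero_of_mul hi, add_sub_cancel _ _⟩, rfl⟩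

theorem exists_of_coeff_mul_ne_zero {G R : Type*} [AddCommGroup G] [LinearOrder G]
    [IsOrderedAddMonoid G] [Field R] {x y : HahnSeries G R} {a : G} (h : (x * y).coeff a ≠ 0) :
    ∃ i j, x.coeff i ≠ 0 ∧ y.coeff j ≠ 0 ∧ i + j = a := by
  rw [coeff_mul_eq_finsum] at h
  obtain ⟨i, hi⟩ := FloerNovikovData.exists_ne_zero_of_finsum h
  exact ⟨i, _, left_ne_zero_of_mul hi, right_ne_zero_of_mul hi, add_sub_cancel _ _⟩

variable {G : AddSubgroup ℝ} {K : Type*} [Field K]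

/-- A Hahn series is left-finite if it has only finitely many terms below each real number. -/
def LeftFinite (f : HahnSeries G K) : Prop :=
  ∀ C : ℝ, {x : G | f.coeff x ≠ 0 ∧ (x : ℝ) < C}.Finite

/-- A strictly decreasing sequence in `T` would give infinitely many elements below a bound just
above its first term. -/
theorem isPWO_of_finite_lt {T : Set G} (h : ∀ C : ℝ, {x : G | x ∈ T ∧ (x : ℝ) < C}.Finite) :
    T.IsPWO := by
  rw [Set.isPWO_iff_isWF, Set.isWF_iff_no_descending_seq]
  intro f hf hmem
  refine Set.infinite_range_of_injective hf.injective
    (((h (f 0 + 1 : ℝ))).subset ?_)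
  rintro _ ⟨n, rfl⟩
  refine ⟨hmem n, ?_⟩
  have : (f n : ℝ) ≤ f 0 := hf.antitone (Nat.zero_le n)
  linarith

theorem LeftFinite.add {f g : HahnSeries G K} (hf : LeftFinite f) (hg : LeftFinite g) :
    LeftFinite (f + g) := fun C => ((hf C).union (hg C)).subset fun x ⟨hx, hC⟩ => by
  by_contra h
  have h1 : f.coeff x = 0 := by_contra fun h' => h (Or.inl ⟨h', hC⟩)
  have h2 : g.coeff x = 0 := by_contra fun h' => h (Or.inr ⟨h', hC⟩)
  exact hx (by rw [coeff_add, h1, h2, add_zero])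

theorem LeftFinite.mul {f g : HahnSeries G K} (hf : LeftFinite f) (hg : LeftFinite g) :
    LeftFinite (f * g) := fun C => by
  refine (((hf (C - g.order)).prod (hg (C - f.order))).image fun x => x.1 + x.2).subset ?_
  rintro a ⟨ha, hC⟩
  obtain ⟨i, j, hi, hj, rfl⟩ := exists_of_coeff_mul_ne_zero ha
  have h1 : (f.order : ℝ) ≤ i := order_le_of_coeff_ne_zero hi
  have h2 : (g.order : ℝ) ≤ j := order_le_of_coeff_ne_zero hj
  rw [AddSubgroup.coe_add] at hC
  exact ⟨(i, j), ⟨⟨hi, by linarith⟩, ⟨hj, by linarith⟩⟩, rfl⟩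

theorem LeftFinite.single (a : G) (r : K) : LeftFinite (single a r) := fun _ =>
  (Set.finite_singleton a).subset fun _ h => by_contra fun h' => h.1 (coeff_single_of_ne h')

/-- The exponents do not accumulate at the leading one, even when `G` is dense in `ℝ`. This gap
replaces discreteness in the proof of `LeftFinite.inv`. -/
theorem LeftFinite.exists_gap {f : HahnSeries G K} (hf : LeftFinite f) :
    ∃ ε : ℝ, 0 < ε ∧ ∀ x, f.coeff x ≠ 0 → x ≠ f.order → f.order + ε ≤ (x : ℝ) := by
  rcases ({x | f.coeff x ≠ 0 ∧ x ≠ f.order}).eq_empty_or_nonempty with h | ⟨y, hy⟩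
  · exact ⟨1, one_pos, fun x hx hne => absurd (show x ∈ (∅ : Set G) from h ▸ ⟨hx, hne⟩) id⟩
  -- The cut at `y + 1` leaves a finite set that still contains `y`, so a second smallest exponent
  -- exists.
  · obtain ⟨z, hz, hmin⟩ := Set.exists_min_image
      {x : G | (f.coeff x ≠ 0 ∧ (x : ℝ) < y + 1) ∧ x ≠ f.order} (fun x => (x : ℝ))
      ((hf _).subset fun _ h => h.1) ⟨y, ⟨hy.1, by linarith⟩, hy.2⟩
    have hlt : (f.order : ℝ) < z :=
      lt_of_le_of_ne (order_le_of_coeff_ne_zero hz.1.1) fun h => hz.2 (Subtype.ext h.symm)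
    refine ⟨z - f.order, sub_pos.mpr hlt, fun x hx hne => ?_⟩
    rw [add_sub_cancel]
    by_cases h : (x : ℝ) < y + 1
    · exact hmin x ⟨⟨hx, h⟩, hne⟩
    · exact hz.1.2.le.trans (not_lt.mp h)

/-- In `f * g = 1`, apart from the exponent `-f.order`, every exponent `y` of `g` comes from another
exponent `j` of `g` and a non-leading exponent `i` of `f`, with `j = y - (i - f.order) ≤ y - ε`. The
support of `g` is thus finite below `g.order + n * ε` by induction on `n`. -/
theorem LeftFinite.inv {f : HahnSeries G K} (hf : LeftFinite f) : LeftFinite f⁻¹ := by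
  by_cases hf0 : f = 0
  · rw [hf0, inv_zero]
    exact fun C => Set.finite_empty.subset fun x h => h.1 rfl
  obtain ⟨ε, hε, hgap⟩ := hf.exists_gap
  set g := f⁻¹ with hg
  have hfg : f * g = 1 := mul_inv_cancel₀ hf0
  have key : ∀ y, g.coeff y ≠ 0 → f.order + y = 0 ∨
      ∃ i j, f.coeff i ≠ 0 ∧ i ≠ f.order ∧ g.coeff j ≠ 0 ∧ i + j = f.order + y := by
    intro y hy
    by_contra! h
    obtain ⟨h0, h⟩ := h
    -- If neither alternative holds, only the leading term of `f` contributes at this exponent, and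
    -- its contribution is nonzero.
    have h1 : (f * g).coeff (f.order + y) = 0 := by
      rw [hfg, coeff_one, if_neg h0]
    rw [coeff_mul_eq_finsum, finsum_eq_single _ f.order, add_sub_cancel_left] at h1
    · exact mul_ne_zero (coeff_order_eq_zero.not.mpr hf0) hy h1
    · intro i hi
      by_contra hne
      exact h i _ (left_ne_zero_of_mul hne) hi (right_ne_zero_of_mul hne) (add_sub_cancel _ _)
  have main : ∀ n : ℕ, {x : G | g.coeff x ≠ 0 ∧ (x : ℝ) < g.order + n * ε}.Finite := by
    intro n
    induction n with
    | zero =>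
      refine Set.finite_empty.subset fun x ⟨hx, hlt⟩ => ?_
      have h1 : (g.order : ℝ) ≤ x := order_le_of_coeff_ne_zero hx
      rw [Nat.cast_zero, zero_mul, add_zero] at hlt
      exact absurd h1 (not_le.mpr hlt)
    | succ n ih =>
      refine ((((hf (f.order + (n + 1) * ε)).prod ih).image
        fun x => x.1 + x.2 - f.order).union (Set.finite_singleton (-f.order))).subset ?_
      rintro y ⟨hy, hlt⟩
      rcases key y hy with h | ⟨i, j, hi, hne, hj, hij⟩
      · exact Or.inr (eq_neg_of_add_eq_zero_right h)
      · left
        have h1 := hgap i hi hne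
        have h2 : (g.order : ℝ) ≤ j := order_le_of_coeff_ne_zero hj
        have h3 : (i : ℝ) + j = f.order + y := congrArg Subtype.val hij
        push_cast at hlt
        refine ⟨(i, j), ⟨⟨hi, by linarith⟩, hj, by linarith⟩, ?_⟩
        change i + j - f.order = y
        rw [hij, add_sub_cancel_left]
  intro C
  obtain ⟨n, hn⟩ := exists_nat_gt ((C - g.order) / ε)
  rw [div_lt_iff₀ hε] at hn
  exact (main n).subset fun x h => ⟨h.1, by linarith [h.2]⟩

variable (G K) in
/-- The field of left-finite Hahn series. -/
def leftFinite : Subfield (HahnSeries G K) where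
  carrier := {f | LeftFinite f}
  mul_mem' := LeftFinite.mul
  one_mem' := LeftFinite.single 0 1
  add_mem' := LeftFinite.add
  zero_mem' := fun _ => Set.finite_empty.subset fun _ h => h.1 rfl
  neg_mem' := fun {f} hf C => (hf C).subset fun x h => ⟨fun h' => h.1 (by simp [h']), h.2⟩
  inv_mem' := fun _ => LeftFinite.inv

open Classical in
variable (G K) in
/-- The valuation `exp (-ord f)` of a Hahn series with real exponents. -/
noncomputable def expValuation : Valuation (HahnSeries G K) ℝ≥0 where
  toFun f := if f = 0 then 0 else Real.toNNReal (Real.exp (-(f.order : ℝ)))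
  map_zero' := if_pos rfl
  map_one' := by simp
  map_mul' f g := by
    by_cases hf : f = 0
    · simp [hf]
    by_cases hg : g = 0
    · simp [hg]
    rw [if_neg hf, if_neg hg, if_neg (mul_ne_zero hf hg), order_mul hf hg,
      ← Real.toNNReal_mul (Real.exp_pos _).le, ← Real.exp_add, AddSubgroup.coe_add, neg_add]
  map_add_le_max' f g := by
    by_cases hf : f = 0
    · simp [hf]
    by_cases hg : g = 0
    · simp [hg]
    by_cases hfg : f + g = 0
    · simp [hfg]
    rw [if_neg hf, if_neg hg, if_neg hfg]
    have h : min (f.order : ℝ) g.order ≤ (f + g).order := by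
      have := min_order_le_order_add hfg
      rcases min_le_iff.mp this with h | h
      · exact min_le_of_left_le h
      · exact min_le_of_right_le h
    rcases min_le_iff.mp h with h | h
    · exact le_max_of_le_left (Real.toNNReal_le_toNNReal (Real.exp_le_exp.mpr (neg_le_neg h)))
    · exact le_max_of_le_right (Real.toNNReal_le_toNNReal (Real.exp_le_exp.mpr (neg_le_neg h)))

/-- Any exponent of `f` will do, not only the leading one; this allows a test of the constant term
alone. -/
theorem exp_le_expValuation {f : HahnSeries G K} {x : G} (hx : f.coeff x ≠ 0) :
    Real.exp (-(x : ℝ)) ≤ expValuation G K f := by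
  have hf : f ≠ 0 := fun h => hx (by rw [h, coeff_zero])
  have h : (f.order : ℝ) ≤ x := order_le_of_coeff_ne_zero hx
  classical
  change _ ≤ ((if f = 0 then 0 else _ : ℝ≥0) : ℝ)
  rw [if_neg hf, Real.coe_toNNReal _ (Real.exp_pos _).le]
  exact Real.exp_le_exp.mpr (neg_le_neg h)

theorem expValuation_single (x : G) {r : K} (hr : r ≠ 0) :
    (expValuation G K (single x r) : ℝ) = Real.exp (-(x : ℝ)) := by
  classical
  change ((if single x r = 0 then 0 else _ : ℝ≥0) : ℝ) = _
  rw [if_neg (single_ne_zero hr), Real.coe_toNNReal _ (Real.exp_pos _).le, order_single hr]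

end HahnSeries

theorem finsum_eq_finsum_comp_of_support_subset_range {α β M : Type*} [AddCommMonoid M]
    {e : α → β} (he : Function.Injective e) {f : β → M} (hf : ∀ b, f b ≠ 0 → b ∈ Set.range e) :
    ∑ᶠ b, f b = ∑ᶠ a, f (e a) := by
  classical
  rw [← finsum_mem_range he]
  refine finsum_congr fun b => ?_
  rw [finsum_eq_if]
  split_ifs with h
  · rfl
  · exact not_imp_comm.mp (hf b) h

/-! ### Chains of one degree as vectors over the left-finite series -/

namespace FloerNovikovData

open HahnSeries

variable {Γ P S : Type*} [AddCommGroup Γ] (X : FloerNovikovData Γ P S)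

/-- The periods of the elements of degree zero. -/
def periodGroup : AddSubgroup ℝ := X.deg.ker.map X.ω

/-- An element of degree zero with the given period. -/
noncomputable def periodLift (x : X.periodGroup) : Γ := (AddSubgroup.mem_map.mp x.2).choose

theorem deg_periodLift (x : X.periodGroup) : X.deg (X.periodLift x) = 0 :=
  (AddSubgroup.mem_map.mp x.2).choose_spec.1

theorem ω_periodLift (x : X.periodGroup) : X.ω (X.periodLift x) = x :=
  (AddSubgroup.mem_map.mp x.2).choose_spec.2

theorem periodLift_injective : Function.Injective X.periodLift := fun x y h =>
  Subtype.ext (by rw [← X.ω_periodLift, h, X.ω_periodLift])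

theorem ω_mem_periodGroup {g : Γ} (hg : X.deg g = 0) : X.ω g ∈ X.periodGroup :=
  AddSubgroup.mem_map.mpr ⟨g, hg, rfl⟩

/-- The points of the base whose fibre contains elements of grading `k`. -/
def GradedBase (k : ℤ) := {s : S // ∃ p, X.proj p = s ∧ X.gr p = k}

theorem finite_gradedBase (k : ℤ) : Finite (X.GradedBase k) :=
  have := X.finite_base
  Subtype.finite

/-- A point of grading `k` in the fibre over `s`. -/
noncomputable def basePoint {k : ℤ} (s : X.GradedBase k) : P := s.2.choose

theorem proj_basePoint {k : ℤ} (s : X.GradedBase k) : X.proj (X.basePoint s) = s.1 :=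
  s.2.choose_spec.1

theorem gr_basePoint {k : ℤ} (s : X.GradedBase k) : X.gr (X.basePoint s) = k :=
  s.2.choose_spec.2

/-- The translate of the base point over `s` with period `x`. -/
noncomputable def point {k : ℤ} (s : X.GradedBase k) (x : X.periodGroup) : P :=
  X.act (X.periodLift x) (X.basePoint s)

theorem A_point {k : ℤ} (s : X.GradedBase k) (x : X.periodGroup) :
    X.A (X.point s x) = X.A (X.basePoint s) - x := by
  rw [point, X.A_act, ω_periodLift]

theorem gr_point {k : ℤ} (s : X.GradedBase k) (x : X.periodGroup) : X.gr (X.point s x) = k := by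
  rw [point, X.gr_act, deg_periodLift, gr_basePoint, sub_zero]

theorem point_injective (k : ℤ) :
    Function.Injective fun y : X.GradedBase k × X.periodGroup => X.point y.1 y.2 := by
  rintro ⟨s, x⟩ ⟨t, y⟩ h
  have hproj : ∀ (s : X.GradedBase k) x, X.proj (X.point s x) = s.1 := fun s x => by
    rw [← X.proj_basePoint s]
    exact ((X.proj_eq_iff _ _).mpr ⟨_, rfl⟩).symm
  have hst : s = t := Subtype.ext (by rw [← hproj s x, ← hproj t y]; exact congrArg X.proj h)
  subst hst
  exact congrArg (Prod.mk s) (X.periodLift_injective (X.act_left_injective _ h))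

theorem point_right_injective {k : ℤ} (s : X.GradedBase k) : Function.Injective (X.point s) :=
  fun _ _ h => (Prod.ext_iff.mp (X.point_injective k (a₁ := (s, _)) (a₂ := (s, _)) h)).2

section

variable {X}

theorem periodLift_ω (hinj : Set.InjOn X.ω {g : Γ | X.deg g = 0})
    {g : Γ} (hg : X.deg g = 0) :
    X.periodLift ⟨X.ω g, X.ω_mem_periodGroup hg⟩ = g :=
  hinj (X.deg_periodLift _) hg (X.ω_periodLift _)

theorem act_neg_periodLift_point (hinj : Set.InjOn X.ω {g : Γ | X.deg g = 0})
    {k : ℤ} (s : X.GradedBase k) (x y : X.periodGroup) :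
    X.act (-X.periodLift y) (X.point s x) = X.point s (x - y) := by
  rw [point, ← X.add_act, point]
  congr 1
  refine hinj ?_ (X.deg_periodLift _) ?_
  · simp [deg_periodLift]
  · simp only [map_add, map_neg, ω_periodLift, AddSubgroup.coe_sub]
    ring

/-- Two points of equal grading in one fibre differ by an element of `ker deg`, which injectivity of
`ω` recovers from its period. Hence the coordinates lose nothing of `C_k`. -/
theorem exists_point (hinj : Set.InjOn X.ω {g : Γ | X.deg g = 0})
    {k : ℤ} {p : P} (hp : X.gr p = k) :
    ∃ (s : X.GradedBase k) (x : X.periodGroup), X.point s x = p := by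
  let s : X.GradedBase k := ⟨X.proj p, p, rfl, hp⟩
  obtain ⟨g, hg⟩ := (X.proj_eq_iff (X.basePoint s) p).mp (X.proj_basePoint s)
  have hdeg : X.deg g = 0 := by
    have := X.gr_act g (X.basePoint s)
    rw [hg, gr_basePoint, hp] at this
    linarith
  exact ⟨s, ⟨X.ω g, X.ω_mem_periodGroup hdeg⟩, by rw [point, periodLift_ω hinj hdeg, hg]⟩

end

variable {K : Type*} [Field K]

theorem finite_coeff_point {k : ℤ} (c : X.chains K) (s : X.GradedBase k) (C : ℝ) :
    {x : X.periodGroup | c.1 (X.point s x) ≠ 0 ∧ (x : ℝ) < C}.Finite := by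
  refine ((c.2.1 (X.A (X.basePoint s) - C)).preimage (X.point_right_injective s).injOn).subset ?_
  rintro x ⟨h, hC⟩
  exact ⟨h, by rw [A_point]; linarith⟩

/-- The coordinates of the degree-`k` part of a chain over the field of left-finite series. -/
noncomputable def coords (k : ℤ) :
    X.chains K →+ (X.GradedBase k → leftFinite X.periodGroup K) where
  toFun c s := ⟨⟨fun x => c.1 (X.point s x), isPWO_of_finite_lt (X.finite_coeff_point c s)⟩,
    X.finite_coeff_point c s⟩
  map_zero' := rfl
  map_add' _ _ := rfl

theorem coords_coeff {k : ℤ} (c : X.chains K) (s : X.GradedBase k) (x : X.periodGroup) :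
    (X.coords k c s).1.coeff x = c.1 (X.point s x) := rfl

open Classical in
theorem coords_gen_point {k : ℤ} (s : X.GradedBase k) (x : X.periodGroup) :
    X.coords k (X.gen K (X.point s x)) =
      Pi.single s ⟨HahnSeries.single x 1, LeftFinite.single x 1⟩ := by
  funext t
  refine Subtype.ext (HahnSeries.ext (funext fun y => ?_))
  rw [coords_coeff]
  by_cases h : (t, y) = (s, x)
  · obtain ⟨rfl, rfl⟩ := Prod.ext_iff.mp h
    rw [gen_self, Pi.single_eq_same, coeff_single_same]
  · rw [not_imp_comm.mp X.eq_of_gen_ne_zero fun e => h (X.point_injective k e)]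
    by_cases ht : t = s
    · subst ht
      rw [Pi.single_eq_same, coeff_single_of_ne fun e => h (by rw [e])]
    · rw [Pi.single_eq_of_ne ht]
      rfl

theorem coords_gen_of_gr_ne {k : ℤ} {p : P} (hp : X.gr p ≠ k) :
    X.coords k (X.gen K p) = 0 := by
  funext t
  refine Subtype.ext (HahnSeries.ext (funext fun y => ?_))
  exact not_imp_comm.mp X.eq_of_gen_ne_zero fun e => hp (by rw [← e, gr_point])

section

variable {X}

theorem eq_zero_of_coords_eq_zero (hinj : Set.InjOn X.ω {g : Γ | X.deg g = 0})
    {k : ℤ} {c : X.chains K} (hc : c ∈ X.graded K k)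
    (h : X.coords k c = 0) : c = 0 := by
  refine Subtype.ext (funext fun p => ?_)
  by_contra hp
  obtain ⟨s, x, rfl⟩ := exists_point hinj (hc p hp)
  exact hp (by rw [← coords_coeff, h]; rfl)

open Classical in
/-- A left-finite series as an element of the Novikov ring. -/
noncomputable def ofSeries (hinj : Set.InjOn X.ω {g : Γ | X.deg g = 0})
    (f : leftFinite X.periodGroup K) : X.novikov K :=
  ⟨fun g => if hg : X.deg g = 0 then f.1.coeff ⟨X.ω g, X.ω_mem_periodGroup hg⟩ else 0, by
    have key : ∀ g, (if hg : X.deg g = 0 then f.1.coeff ⟨X.ω g, X.ω_mem_periodGroup hg⟩ else 0) ≠ 0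
        → ∃ hg : X.deg g = 0, f.1.coeff ⟨X.ω g, X.ω_mem_periodGroup hg⟩ ≠ 0 := by
      intro g h
      by_cases hg : X.deg g = 0
      · exact ⟨hg, by rwa [dif_pos hg] at h⟩
      · exact absurd (dif_neg hg) h
    constructor
    · intro C
      refine ((f.2 C).image X.periodLift).subset ?_
      rintro g ⟨h, hC⟩
      obtain ⟨hg, hf⟩ := key g h
      exact ⟨_, ⟨hf, hC⟩, periodLift_ω hinj hg⟩
    · refine (Set.finite_singleton 0).subset ?_
      rintro _ ⟨g, h, rfl⟩
      exact (key g h).1⟩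

theorem deg_eq_zero_of_ofSeries (hinj : Set.InjOn X.ω {g : Γ | X.deg g = 0})
    {f : leftFinite X.periodGroup K} {g : Γ}
    (h : (ofSeries hinj f).1 g ≠ 0) : X.deg g = 0 := by
  by_contra hg
  exact h (dif_neg hg)

theorem ofSeries_periodLift (hinj : Set.InjOn X.ω {g : Γ | X.deg g = 0})
    (f : leftFinite X.periodGroup K) (x : X.periodGroup) :
    (ofSeries hinj f).1 (X.periodLift x) = f.1.coeff x := by
  refine (dif_pos (X.deg_periodLift x)).trans ?_
  congr 1
  exact Subtype.ext (X.ω_periodLift x)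

theorem ofSeries_smul_mem_graded (hinj : Set.InjOn X.ω {g : Γ | X.deg g = 0})
    {k : ℤ} (f : leftFinite X.periodGroup K) {c : X.chains K}
    (hc : c ∈ X.graded K k) : X.novikovSMul (ofSeries hinj f) c ∈ X.graded K k := by
  intro p hp
  obtain ⟨g, hg⟩ := exists_ne_zero_of_finsum (f := fun g => _ * c.1 (X.act (-g) p)) hp
  have h1 := hc _ (right_ne_zero_of_mul hg)
  rw [X.gr_act, map_neg, deg_eq_zero_of_ofSeries hinj (left_ne_zero_of_mul hg)] at h1
  simpa using h1

theorem coords_ofSeries_smul (hinj : Set.InjOn X.ω {g : Γ | X.deg g = 0})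
    (k : ℤ) (f : leftFinite X.periodGroup K) (c : X.chains K) :
    X.coords k (X.novikovSMul (ofSeries hinj f) c) = fun s => f * X.coords k c s := by
  funext s
  refine Subtype.ext (HahnSeries.ext (funext fun x => ?_))
  rw [coords_coeff]
  change ∑ᶠ g, (ofSeries hinj f).1 g * c.1 (X.act (-g) (X.point s x)) =
    (f.1 * (X.coords k c s).1).coeff x
  rw [coeff_mul_eq_finsum, finsum_eq_finsum_comp_of_support_subset_range X.periodLift_injective]
  · refine finsum_congr fun y => ?_
    rw [ofSeries_periodLift, act_neg_periodLift_point hinj, coords_coeff]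
  · intro g hg
    exact ⟨_, periodLift_ω hinj (deg_eq_zero_of_ofSeries hinj (left_ne_zero_of_mul hg))⟩

-- Translation by period `x` multiplies by the monomial of exponent `x`, so by linearity the values
-- of `φ` on generators are shifts of the finitely many series `φ (Pi.single s 1)`.
open Classical in
theorem apply_coords_gen_point {k : ℤ}
    (φ : (X.GradedBase k → leftFinite X.periodGroup K) →ₗ[leftFinite X.periodGroup K]
      leftFinite X.periodGroup K) (s : X.GradedBase k) (x y : X.periodGroup) :
    (φ (X.coords k (X.gen K (X.point s x)))).1.coeff y = (φ (Pi.single s 1)).1.coeff (y - x) := by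
  have h : X.coords k (X.gen K (X.point s x)) =
      fun t => (⟨HahnSeries.single x 1, LeftFinite.single x 1⟩ : leftFinite X.periodGroup K) *
        (Pi.single s 1 : X.GradedBase k → leftFinite X.periodGroup K) t := by
    rw [coords_gen_point]
    funext t
    by_cases ht : t = s
    · rw [ht, Pi.single_eq_same, Pi.single_eq_same, mul_one]
    · rw [Pi.single_eq_of_ne ht, Pi.single_eq_of_ne ht, mul_zero]
  rw [h]
  refine (congrArg (fun z => z.1.coeff y) (φ.map_smul _ (Pi.single s 1))).trans ?_
  change (HahnSeries.single x 1 * (φ (Pi.single s 1)).1).coeff y = _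
  rw [coeff_single_mul, one_mul]

/-- The chain of the opposite complex that represents the constant term of a functional. -/
noncomputable def dualChain (hinj : Set.InjOn X.ω {g : Γ | X.deg g = 0})
    {k : ℤ}
    (φ : (X.GradedBase k → leftFinite X.periodGroup K) →ₗ[leftFinite X.periodGroup K]
      leftFinite X.periodGroup K) : X.op.chains K :=
  ⟨fun p => (φ (X.coords k (X.gen K p))).1.coeff 0, by
    classical
    have := X.finite_gradedBase k
    have key : ∀ p, (φ (X.coords k (X.gen K p))).1.coeff 0 ≠ 0 → X.gr p = k := by
      intro p h
      by_contra hp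
      exact h (by rw [X.coords_gen_of_gr_ne hp, map_zero]; rfl)
    constructor
    · intro C
      have hfin : ∀ s : X.GradedBase k, {y : X.periodGroup |
          (φ (Pi.single s 1)).1.coeff y ≠ 0 ∧ (y : ℝ) < -X.A (X.basePoint s) - C}.Finite :=
        fun s => (φ (Pi.single s 1)).2 _
      refine (Set.finite_iUnion fun s => (hfin s).image fun y => X.point s (-y)).subset ?_
      rintro p ⟨h, hC⟩
      obtain ⟨s, x, rfl⟩ := exists_point hinj (key p h)
      replace h : (φ (X.coords k (X.gen K (X.point s x)))).1.coeff 0 ≠ 0 := h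
      rw [apply_coords_gen_point, zero_sub] at h
      have hC' : C < -X.A (X.point s x) := hC
      rw [A_point] at hC'
      -- The coefficient at the point of period `x` is that of `φ (Pi.single s 1)` at `-x`, so
      -- left-finiteness of the latter is exactly the finiteness required for `-𝒜`.
      refine Set.mem_iUnion.mpr ⟨s, -x, ⟨h, ?_⟩, by simp only [neg_neg]⟩
      rw [AddSubgroup.coe_neg]
      linarith
    · refine (Set.finite_singleton (-k)).subset ?_
      rintro _ ⟨p, h, rfl⟩
      exact congrArg Neg.neg (key p h)⟩

theorem dualChain_apply (hinj : Set.InjOn X.ω {g : Γ | X.deg g = 0}) {k : ℤ}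
    (φ : (X.GradedBase k → leftFinite X.periodGroup K) →ₗ[leftFinite X.periodGroup K]
      leftFinite X.periodGroup K) (p : P) :
    (dualChain hinj φ).1 p = (φ (X.coords k (X.gen K p))).1.coeff 0 := rfl

theorem dualChain_mem_graded (hinj : Set.InjOn X.ω {g : Γ | X.deg g = 0}) {k : ℤ}
    (φ : (X.GradedBase k → leftFinite X.periodGroup K) →ₗ[leftFinite X.periodGroup K]
      leftFinite X.periodGroup K) : dualChain hinj φ ∈ X.op.graded K (-k) := by
  intro p h
  change -X.gr p = -k
  by_contra hp
  refine h ?_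
  rw [dualChain_apply, X.coords_gen_of_gr_ne fun e => hp (by rw [e]), map_zero]
  rfl

end

end FloerNovikovData

/-! ### The dual cycle and the two inequalities -/

namespace FloerNovikovComplex

open HahnSeries FloerNovikovData

variable {K Γ P S : Type*} [Field K] [AddCommGroup Γ] {X : FloerNovikovComplex K Γ P S}

/-- Expanding `φ` in the standard basis turns its constant term into a finite sum of convolutions,
one for each fibre; together they run over all points of grading `k`, the only ones where the dual
chain can be nonzero. -/
theorem pairing_dualChain (hinj : Set.InjOn X.ω {g : Γ | X.deg g = 0}) {k : ℤ}
    (φ : (X.GradedBase k → leftFinite X.periodGroup K) →ₗ[leftFinite X.periodGroup K]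
      leftFinite X.periodGroup K) (c : X.chains K) :
    X.pairing (dualChain hinj φ) c = (φ (X.coords k c)).1.coeff 0 := by
  classical
  have := X.finite_gradedBase k
  have := Fintype.ofFinite (X.GradedBase k)
  change ∑ᶠ p, (dualChain hinj φ).1 p * c.1 p = _
  rw [finsum_eq_finsum_comp_of_support_subset_range (X.point_injective k),
    finsum_curry, finsum_eq_sum_of_fintype]
  · rw [LinearMap.pi_apply_eq_sum_univ φ (X.coords k c), AddSubmonoidClass.coe_finsetSum,
      HahnSeries.coeff_sum]
    refine Finset.sum_congr rfl fun s _ => ?_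
    change _ = ((X.coords k c s).1 * (φ _).1).coeff 0
    rw [coeff_mul_eq_finsum]
    refine finsum_congr fun x => ?_
    dsimp only
    rw [dualChain_apply, apply_coords_gen_point, coords_coeff, mul_comm]
    -- `LinearMap.pi_apply_eq_sum_univ` writes basis vectors as `if s = t then 1 else 0`, to be
    -- matched with `Pi.single s 1`.
    congr 5
    funext t
    simp only [Pi.single_apply, eq_comm]
  · exact (X.finite_pairing_support _ c).preimage (X.point_injective k).injOn
  · intro p hp
    have h := dualChain_mem_graded hinj φ p (left_ne_zero_of_mul hp)
    obtain ⟨s, x, hx⟩ := exists_point hinj (neg_injective h)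
    exact ⟨(s, x), hx⟩

variable (X) in
theorem pairing_gen (d : X.op.chains K) (p : P) : X.pairing d (X.gen K p) = d.1 p := by
  rw [pairing_apply, finsum_eq_single _ p, gen_self, mul_one]
  intro q hq
  rw [not_imp_comm.mp X.eq_of_gen_ne_zero hq, mul_zero]

theorem exists_chain_representing_functional (hinj : Set.InjOn X.ω {g : Γ | X.deg g = 0}) {k : ℤ}
    (φ : (X.GradedBase k → leftFinite X.periodGroup K) →ₗ[leftFinite X.periodGroup K]
      leftFinite X.periodGroup K) :
    ∃ d ∈ X.op.graded K (-k), ∀ c, X.pairing d c = (φ (X.coords k c)).1.coeff 0 :=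
  ⟨_, dualChain_mem_graded hinj φ, pairing_dualChain hinj φ⟩

/-- The boundaries `∂ C_{k+1}` in coordinates. -/
noncomputable def boundaryCoords (hinj : Set.InjOn X.ω {g : Γ | X.deg g = 0}) (k : ℤ) :
    Submodule (leftFinite X.periodGroup K) (X.GradedBase k → leftFinite X.periodGroup K) where
  carrier := {y | ∃ x ∈ X.graded K (k + 1), X.coords k (X.d x) = y}
  zero_mem' := ⟨0, Submodule.zero_mem _, by rw [map_zero, map_zero]⟩
  add_mem' := by
    rintro _ _ ⟨x, hx, rfl⟩ ⟨y, hy, rfl⟩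
    exact ⟨x + y, Submodule.add_mem _ hx hy, by rw [map_add, map_add]⟩
  smul_mem' := by
    rintro f _ ⟨x, hx, rfl⟩
    refine ⟨_, ofSeries_smul_mem_graded hinj f hx, ?_⟩
    rw [X.d_novikovSMul, coords_ofSeries_smul]
    rfl

/-- Hahn–Banach in coordinates, carried back to chains. Comparing `𝒜` point by point on the supports
matches the coordinatewise form of the norm bound. -/
theorem exists_dual_cycle (hinj : Set.InjOn X.ω {g : Γ | X.deg g = 0}) {k : ℤ} (c : X.cycles k)
    (hc : (X.boundaries k).mkQ c ≠ 0) :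
    ∃ c' : X.cycles k, (X.boundaries k).mkQ c' = (X.boundaries k).mkQ c ∧
      ∃ d : X.op.cycles (-k), X.pairing d.1 c.1 = 1 ∧
        ∀ p q, d.1.1 p ≠ 0 → c'.1.1 q ≠ 0 → X.A q ≤ X.A p := by
  classical
  have := X.finite_gradedBase k
  let v : Valuation (leftFinite X.periodGroup K) ℝ≥0 :=
    (expValuation X.periodGroup K).comap (leftFinite X.periodGroup K).subtype
  -- With these weights a monomial of exponent `x` over `s` has norm `exp (𝒜 (X.point s x))`,
  -- because `𝒜` drops by `x` along the fibre.
  let w : X.GradedBase k → ℝ≥0 := fun s => ⟨Real.exp (X.A (X.basePoint s)), (Real.exp_pos _).le⟩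
  have hw : ∀ s, w s ≠ 0 := fun s h => (Real.exp_pos _).ne' (congrArg NNReal.toReal h)
  have hd_mem : ∀ {x}, x ∈ X.graded K (k + 1) → X.d x ∈ X.graded K k := fun {x} hx => by
    simpa using X.d_mem_graded _ _ hx
  have hcU : X.coords k c.1 ∉ boundaryCoords hinj k := by
    rintro ⟨x, hx, e⟩
    refine hc ((Submodule.Quotient.mk_eq_zero _).mpr ⟨x, hx, sub_eq_zero.mp ?_⟩)
    refine eq_zero_of_coords_eq_zero hinj (k := k) (Submodule.sub_mem _ (hd_mem hx) c.2.1) ?_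
    rw [map_sub, e, sub_eq_zero]
    rfl
  obtain ⟨y, ⟨x, hx, hy⟩, φ, hφ, hφc, hle⟩ :=
    exists_functional_and_best_approximation v w hw _ _ hcU
  have hy' : y = X.coords k (c.1 + X.d x) := by rw [map_add, hy, add_sub_cancel]
  have hcyc : X.d x ∈ X.cycles k := ⟨hd_mem hx, X.d_d x⟩
  obtain ⟨d, hdgr, hd⟩ := exists_chain_representing_functional hinj φ
  -- The coefficient of `δd` at `q` is `Δ(d, ∂q)`, the constant term of `φ(∂q)`. It can be nonzero
  -- only for `q` of grading `k + 1`, and then `∂q` lies in the boundaries, where `φ` vanishes.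
  have hδ : X.op.d d = 0 := by
    refine Subtype.ext (funext fun q => ?_)
    by_contra hq
    have hgr : -X.gr q = -k - 1 :=
      X.op.d_mem_graded _ _ (hdgr) q hq
    refine hq ?_
    rw [← X.pairing_gen (X.op.d _), X.pairing_d, hd, hφ]
    · rfl
    · refine ⟨X.gen K q, fun r hr => ?_, rfl⟩
      rw [X.eq_of_gen_ne_zero hr]
      linarith
  refine ⟨c + ⟨X.d x, hcyc⟩, ?_, ⟨d, hdgr, hδ⟩, ?_, ?_⟩
  · rw [map_add, add_eq_left]
    exact (Submodule.Quotient.mk_eq_zero _).mpr ⟨x, hx, rfl⟩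
  · rw [hd, hφc]
    exact coeff_one.trans (if_pos rfl)
  · intro p q hp hq
    obtain ⟨s, a, rfl⟩ := exists_point hinj (neg_injective (hdgr p hp))
    obtain ⟨t, b, rfl⟩ := exists_point hinj ((c + ⟨X.d x, hcyc⟩).2.1 q hq)
    -- A nonzero coefficient of `d` at a generator is a nonzero constant term of `φ` there, which
    -- forces valuation at least `exp 0`.
    have h1 : (1 : ℝ) ≤ v (φ (X.coords k (X.gen K (X.point s a)))) := by
      rw [← X.pairing_gen, hd] at hp
      have h := exp_le_expValuation hp
      rwa [AddSubgroup.coe_zero, neg_zero, Real.exp_zero] at h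
    have h2 : Real.exp (-(b : ℝ)) ≤ v (y t) := by
      rw [hy']
      exact exp_le_expValuation hq
    -- The bound `M` is the norm of the generator itself.
    have h3 := hle (X.coords k (X.gen K (X.point s a)))
      ⟨Real.exp (X.A (X.point s a)), (Real.exp_pos _).le⟩ (fun r => ?_) t
    · have h4 : (v (φ (X.coords k (X.gen K (X.point s a)))) : ℝ) *
          (v (y t) * Real.exp (X.A (X.basePoint t))) ≤ Real.exp (X.A (X.point s a)) := h3
      have h5 : Real.exp (X.A (X.point t b)) ≤ v (y t) * Real.exp (X.A (X.basePoint t)) := by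
        rw [A_point, sub_eq_neg_add, Real.exp_add]
        exact mul_le_mul_of_nonneg_right h2 (Real.exp_pos _).le
      refine Real.exp_le_exp.mp (h5.trans (le_trans ?_ h4))
      exact le_mul_of_one_le_left ((Real.exp_pos _).le.trans h5) h1
    · rw [coords_gen_point]
      by_cases hr : r = s
      · subst hr
        rw [Pi.single_eq_same]
        refine NNReal.coe_le_coe.mp (le_of_eq ?_)
        change (expValuation X.periodGroup K (HahnSeries.single a 1) : ℝ) *
          Real.exp (X.A (X.basePoint r)) = Real.exp (X.A (X.point r a))
        rw [expValuation_single a one_ne_zero, A_point, sub_eq_neg_add, Real.exp_add]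
      · rw [Pi.single_eq_of_ne hr, map_zero, zero_mul]
        exact zero_le

/-- A nonzero pairing has a nonzero term, that is, a generator in both supports, whose action bounds
both levels. -/
theorem le_level_of_pairing_ne_zero {d : X.op.chains K} {c : X.chains K}
    (h : X.pairing d c ≠ 0) : -X.op.level d ≤ X.level c := by
  rw [pairing_apply] at h
  obtain ⟨p, hp⟩ := exists_ne_zero_of_finsum h
  refine le_trans ?_ (X.le_level c (right_ne_zero_of_mul hp))
  rw [EReal.neg_le]
  exact X.op.le_level d (left_ne_zero_of_mul hp)

theorem neg_spectralNumber_le {k : ℤ} {a : X.homology k} {b : X.op.homology (-k)}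
    (h : X.homologyPairing k b a ≠ 0) : -X.op.spectralNumber b ≤ X.spectralNumber a := by
  refine le_iInf ?_
  rintro ⟨c, rfl⟩
  rw [EReal.neg_le]
  refine le_iInf ?_
  rintro ⟨d, rfl⟩
  rw [EReal.neg_le]
  exact le_level_of_pairing_ne_zero h

end FloerNovikovComplex

theorem mainTheorem2 {K Γ P S : Type*} [Field K] [AddCommGroup Γ]
    (X : FloerNovikovComplex K Γ P S)
    (hinj : Set.InjOn X.ω {g : Γ | X.deg g = 0})
    (k : ℤ) (a : X.homology k) (ha : a ≠ 0) :
    X.spectralNumber a ≠ ⊥ ∧ X.spectralNumber a ≠ ⊤ ∧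
      X.spectralNumber a =
        -sInf {r : EReal | ∃ b : X.op.homology (-k),
          X.homologyPairing k b a ≠ 0 ∧ r = X.op.spectralNumber b} := by
  obtain ⟨c, rfl⟩ := (X.boundaries k).mkQ_surjective a
  obtain ⟨c', hc', d, hd, hle⟩ := FloerNovikovComplex.exists_dual_cycle hinj c ha
  have hpair : X.homologyPairing k ((X.op.boundaries (-k)).mkQ d) ((X.boundaries k).mkQ c) ≠ 0 := by
    rw [show X.homologyPairing k ((X.op.boundaries (-k)).mkQ d) ((X.boundaries k).mkQ c) = 1
      from hd]
    exact one_ne_zero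
  have hd0 : d.1 ≠ 0 := fun h => by
    rw [h, map_zero, LinearMap.zero_apply] at hd
    exact zero_ne_one hd
  have hc0 : c'.1 ≠ 0 := fun h => ha (by
    rw [← hc', show c' = 0 from Subtype.ext h, map_zero])
  obtain ⟨p, hp, hlp⟩ := X.op.exists_level_eq d.1 hd0
  obtain ⟨q, hq, hlq⟩ := X.exists_level_eq c'.1 hc0
  have hρc : X.spectralNumber ((X.boundaries k).mkQ c) ≤ X.A q :=
    (iInf_le _ ⟨c', hc'⟩).trans_eq hlq
  have hρd : X.op.spectralNumber ((X.op.boundaries (-k)).mkQ d) ≤ ((-X.A p : ℝ) : EReal) :=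
    (iInf_le _ ⟨d, rfl⟩).trans_eq hlp
  have hlow := FloerNovikovComplex.neg_spectralNumber_le hpair
  have hpρ : (X.A p : EReal) ≤ -X.op.spectralNumber ((X.op.boundaries (-k)).mkQ d) := by
    rw [EReal.le_neg]
    exact hρd
  refine ⟨((EReal.bot_lt_coe _).trans_le (hpρ.trans hlow)).ne',
    (hρc.trans_lt (EReal.coe_lt_top _)).ne, le_antisymm ?_ ?_⟩
  -- The only use of the separation of supports: `ρ(a) ≤ 𝒜(q) ≤ 𝒜(p) ≤ -ρ([d])`, where `[d]` pairs
  -- to `1` with `a` and so competes in the infimum.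
  · refine (hρc.trans (EReal.coe_le_coe_iff.mpr (hle p q hp hq))).trans (hpρ.trans ?_)
    exact EReal.neg_le_neg_iff.mpr (sInf_le ⟨_, hpair, rfl⟩)
  · rw [EReal.neg_le]
    refine le_sInf ?_
    rintro _ ⟨b, hb, rfl⟩
    rw [EReal.neg_le]
    exact FloerNovikovComplex.neg_spectralNumber_le hb
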